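/- Let $k\ge 1$ and $n\ge 1$ be integers. A weighted partition of $[n]=\{1,\dots,n\}$ with $k$ layers is a sequence $\pi=(\pi^{(1)},\dots,\pi^{(k)})$ of set partitions of $[n]$ such that $\pi^{(l+1)}$ refines $\pi^{(l)}$ for $1\le l<k$ (in the layers $l\ge 2$ singleton blocks are usually not written). Let $\mathcal P_n^{(k)}$ be the set of these weighted partitions. For $\pi,\pi'\in\mathcal P_n^{(k)}$, integers $1\le\alpha<\beta\le n$ and $l\in[k]$, write $\pi\xrightarrow{(\alpha,\beta)_l}\pi'$ if 1. $\alpha$ and $\beta$ lie in different blocks of $\pi^{(1)}$, and $\beta$ is the least element of its block in $\pi^{(1)}$; 2. $\alpha$ and $\beta$ are the least elements of their (necessarily different) blocks in $\pi^{(l)}$; 3. for every $l'\le l$, $\pi'^{(l')}$ is obtained from $\pi^{(l')}$ by merging the block containing $\alpha$ with the block containing $\beta$, and $\pi'^{(l')}=\pi^{(l')}$ for $l'>l$. Put $\pi\lessdot\pi'$ if $\pi\xrightarrow{(\alpha,\beta)_l}\pi'$ for some $(\alpha,\beta)_l$, and let $\le$ be the reflexive transitive closure of $\lessdot$. This makes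 $\mathcal P_n^{(k)}$ a finite poset with least element $\hat 0=1/2/\cdots/n$. Let $\mathcal L_n^{(k)}$ be the poset obtained from it by adding a new greatest element $\hat 1$, and let $\mu(\mathcal L_n^{(k)})=\mu(\hat 0,\hat 1)$, where $\mu$ is the Möbius function of $\mathcal L_n^{(k)}$, defined by $\mu(x,x)=1$ and $\mu(x,y)=-\sum_{x\le z<y}\mu(x,z)$ for $x<y$. **Theorem.** For every $k\ge 1$, in the ring of formal power series $\mathbb Q[[x]]$, $$\Gamma^{(k)}(x):=\sum_{n\ge 0}(-1)^{n+1}\mu\bigl(\mathcal L_{n+1}^{(k)}\bigr)\frac{x^n}{n!}=(1-kx)^{-(k-1)/k},$$ where $(1-kx)^{a}:=\sum_{n\ge 0}\binom{a}{n}(-k)^n x^n$. Moreover, for all $k\ge1$ and $n\ge1$, $$\mu\bigl(\mathcal L_n^{(k)}\bigr)=(-1)^n\prod_{j=0}^{n-2}\bigl(k(j+1)-1\bigr).$$ -/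

import Mathlib

/-- A weighted partition of `{1, …, n}` with `k` layers (points are indexed by `Fin n` and layers
by `Fin k`, both starting from `0`).  Layer `0` is the first layer, a set partition of the points;
each further layer is a partition of the blocks of the preceding one.  A layer is recorded as a
complete equivalence relation, so that points not listed in a deeper layer are exactly the
singleton classes of that layer; the sets listed there are the classes with at least two
elements. -/
@[ext]
structure WeightedPartition (n k : ℕ) where
  layer : Fin k → Setoid (Fin n)
  antitone : Antitone layer

namespace WeightedPartition

variable {n k : ℕ}

/-- The first layer is the coarsest one; it exists as soon as some layer `l` does. -/
def firstOf (l : Fin k) : Fin k := ⟨0, l.pos⟩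

/-- `p.Step α β l q`: there is an admissible edge `p → q` with label `(α, β)_l`.
The points `α < β` lie in different blocks of the first layer, `β` is the least element of its
block in the first layer, and in layer `l` the points `α` and `β` lie in different blocks and are
the least elements of these.  In `q`, the block of `α` and the block of `β` are merged in layer `l`
and in all coarser layers, and nothing else is changed. -/
structure Step (p : WeightedPartition n k) (α β : Fin n) (l : Fin k)
    (q : WeightedPartition n k) : Prop where
  lt : α < β
  first_ne : ¬ p.layer (firstOf l) α β
  first_least : ∀ c, p.layer (firstOf l) β c → β ≤ c
  layer_ne : ¬ p.layer l α β
  layer_least_left : ∀ c, p.layer l α c → α ≤ c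
  layer_least_right : ∀ c, p.layer l β c → β ≤ c
  merge : ∀ m x y, q.layer m x y ↔ p.layer m x y ∨
    (m ≤ l ∧ (p.layer m x α ∧ p.layer m y β ∨ p.layer m x β ∧ p.layer m y α))

/-- The covering relation of the poset of weighted partitions. -/
def Covers (p q : WeightedPartition n k) : Prop := ∃ α β l, p.Step α β l q

theorem Covers.layer_le {p q : WeightedPartition n k} (h : p.Covers q) (m : Fin k) :
    p.layer m ≤ q.layer m := by
  obtain ⟨α, β, l, h⟩ := h
  intro x y hxy
  exact (h.merge m x y).2 (Or.inl hxy)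

theorem layer_le_of_reflTransGen {p q : WeightedPartition n k}
    (h : Relation.ReflTransGen Covers p q) (m : Fin k) : p.layer m ≤ q.layer m := by
  induction h with
  | refl => exact le_rfl
  | tail _ h ih => exact ih.trans (h.layer_le m)

/-- The order generated by the covering relation: `p ≤ q` if there is a chain of coverings
from `p` to `q`. -/
instance : PartialOrder (WeightedPartition n k) where
  le := Relation.ReflTransGen Covers
  le_refl _ := Relation.ReflTransGen.refl
  le_trans _ _ _ := Relation.ReflTransGen.trans
  le_antisymm _ _ h₁ h₂ := WeightedPartition.ext <| funext fun m =>
    le_antisymm (layer_le_of_reflTransGen h₁ m) (layer_le_of_reflTransGen h₂ m)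

instance : Finite (WeightedPartition n k) :=
  Finite.of_injective (fun p m x y => p.layer m x y : _ → Fin k → Fin n → Fin n → Prop)
    fun _ _ h => WeightedPartition.ext <| funext fun m => Setoid.ext fun x y => by
      have := congrFun (congrFun (congrFun h m) x) y
      exact iff_of_eq this

/-- The weighted partition `1/2/…/n`, all of whose blocks in all layers are singletons. -/
def discrete (n k : ℕ) : WeightedPartition n k := ⟨fun _ => ⊥, fun _ _ _ => le_rfl⟩

/-- The weighted partition obtained from `p` by isolating the point `b` in every layer. -/
def isolate (p : WeightedPartition n k) (b : Fin n) : WeightedPartition n k where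
  layer m :=
    { r := fun x y => x = y ∨ (x ≠ b ∧ y ≠ b ∧ p.layer m x y)
      iseqv :=
        { refl := fun _ => Or.inl rfl
          symm := by
            rintro x y (h | ⟨hx, hy, h⟩)
            · exact Or.inl h.symm
            · exact Or.inr ⟨hy, hx, (p.layer m).symm h⟩
          trans := by
            rintro x y z (rfl | ⟨hx, hy, h⟩) (rfl | ⟨hy', hz, h'⟩)
            · exact Or.inl rfl
            · exact Or.inr ⟨hy', hz, h'⟩
            · exact Or.inr ⟨hx, hy, h⟩
            · exact Or.inr ⟨hx, hz, (p.layer m).trans h h'⟩ } }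
  antitone m m' hm := by
    rintro x y (h | ⟨hx, hy, h⟩)
    · exact Or.inl h
    · exact Or.inr ⟨hx, hy, p.antitone hm h⟩

theorem exists_step_isolate (p : WeightedPartition n k) (hp : p ≠ discrete n k) :
    ∃ a b l, (p.isolate b).Step a b l p ∧ a ≠ b ∧ p.layer l b a := by
  have hne : ∃ l : Fin k, ∃ x y, x ≠ y ∧ p.layer l x y := by
    by_contra! hcon
    refine hp (WeightedPartition.ext <| funext fun m => Setoid.ext fun x y => ?_)
    constructor
    · intro h
      by_contra hxy
      exact hcon m x y hxy h
    · intro h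
      obtain rfl : x = y := h
      exact (p.layer m).refl x
  obtain ⟨l, ⟨x, y, hxy, h⟩, hmax⟩ :=
    Set.Finite.exists_maximalFor id {l : Fin k | ∃ x y, x ≠ y ∧ p.layer l x y}
      (Set.toFinite _) hne
  have hmax' : ∀ m x y, x ≠ y → p.layer m x y → m ≤ l := fun m x y hxy h => by
    rcases le_total m l with h' | h'
    · exact h'
    · exact hmax ⟨x, y, hxy, h⟩ h'
  obtain ⟨a, hxa, ha⟩ : ∃ a, p.layer l x a ∧ ∀ c, p.layer l x c → a ≤ c := by
    obtain ⟨a, ha, hmin⟩ := Set.Finite.exists_minimalFor id {c | p.layer l x c}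
      (Set.toFinite _) ⟨x, (p.layer l).refl x⟩
    refine ⟨a, ha, fun c hc => ?_⟩
    rcases le_total a c with h' | h'
    · exact h'
    · exact hmin hc h'
  obtain ⟨b, hxb, hab⟩ : ∃ b, p.layer l x b ∧ a ≠ b := by
    by_cases hax : a = x
    · exact ⟨y, h, fun hay => hxy (hax.symm.trans hay)⟩
    · exact ⟨x, (p.layer l).refl x, hax⟩
  have hba : p.layer l b a := (p.layer l).trans ((p.layer l).symm hxb) hxa
  have hiso : ∀ m c, (p.isolate b).layer m b c → b = c := by
    rintro m c (h | ⟨h, _, _⟩)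
    · exact h
    · exact absurd rfl h
  have hiso' : ∀ m c, (p.isolate b).layer m c b → c = b := fun m c h =>
    (hiso m c ((p.isolate b).layer m |>.symm h)).symm
  refine ⟨a, b, l, ⟨lt_of_le_of_ne (ha b hxb) hab, fun h => hab (hiso' _ _ h),
    fun c h => (hiso _ c h).le, fun h => hab (hiso' _ _ h), ?_,
    fun c h => (hiso _ c h).le, ?_⟩, hab, hba⟩
  · rintro c (h | ⟨_, _, h⟩)
    · exact h.le
    · exact ha c ((p.layer l).trans hxa h)
  · intro m u v
    have hm : m ≤ l → p.layer m b a := fun hm => p.antitone hm hba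
    constructor
    · intro h
      by_cases huv : u = v
      · exact Or.inl (Or.inl huv)
      have hml := hmax' m u v huv h
      by_cases hu : u = b
      · subst hu
        refine Or.inr ⟨hml, Or.inr ⟨Or.inl rfl, Or.inr ⟨fun h => huv h.symm, hab, ?_⟩⟩⟩
        exact (p.layer m).trans ((p.layer m).symm h) (hm hml)
      · by_cases hv : v = b
        · subst hv
          exact Or.inr ⟨hml, Or.inl ⟨Or.inr ⟨hu, hab, (p.layer m).trans h (hm hml)⟩, Or.inl rfl⟩⟩
        · exact Or.inl (Or.inr ⟨hu, hv, h⟩)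
    · have hle : ∀ x y, (p.isolate b).layer m x y → p.layer m x y := by
        rintro x y (rfl | ⟨_, _, h⟩)
        · exact (p.layer m).refl _
        · exact h
      rintro (h | ⟨hml, ⟨h₁, h₂⟩ | ⟨h₁, h₂⟩⟩)
      · exact hle _ _ h
      · obtain rfl := hiso' _ _ h₂
        exact (p.layer m).trans (hle _ _ h₁) ((p.layer m).symm (hm hml))
      · obtain rfl := hiso' _ _ h₁
        exact (p.layer m).trans (hm hml) ((p.layer m).symm (hle _ _ h₂))

theorem discrete_le (p : WeightedPartition n k) : discrete n k ≤ p := by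
  generalize hN : {b | ∃ m x, b ≠ x ∧ p.layer m b x}.ncard = N
  induction N using Nat.strong_induction_on generalizing p with
  | _ N ih =>
    by_cases hp : p = discrete n k
    · exact hp ▸ le_rfl
    obtain ⟨a, b, l, hstep, hab, hba⟩ := p.exists_step_isolate hp
    refine le_trans (ih _ ?_ (p.isolate b) rfl)
      (Relation.ReflTransGen.single ⟨a, b, l, hstep⟩)
    rw [← hN]
    refine Set.ncard_lt_ncard ⟨?_, fun hss => ?_⟩ (Set.toFinite _)
    · rintro c ⟨m, x, hcx, h | ⟨_, _, h⟩⟩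
      · exact absurd h hcx
      · exact ⟨m, x, hcx, h⟩
    · obtain ⟨m, x, hbx, h | ⟨h, _, _⟩⟩ := hss ⟨l, a, hab.symm, hba⟩
      · exact hbx h
      · exact h rfl

/-- The least element is `1/2/…/n`. -/
instance : OrderBot (WeightedPartition n k) where
  bot := discrete n k
  bot_le := discrete_le

end WeightedPartition

/-- The poset `L_n^(k)` obtained from the poset of weighted partitions by adding a new greatest element
(also when, as for `k = 1` or `n = 1`, a greatest element is already present). -/
abbrev BoundedWeightedPartition (n k : ℕ) : Type := WithTop (WeightedPartition n k)

open scoped Classical in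
/-- `μ(P) = μ(0̂, 1̂)`, the Möbius function of a finite bounded poset evaluated at its least and
greatest elements. -/
noncomputable def mobiusNumber (P : Type*) [PartialOrder P] [BoundedOrder P] [Finite P] : ℤ :=
  letI : Fintype P := Fintype.ofFinite P
  letI : LocallyFiniteOrder P := Fintype.toLocallyFiniteOrder
  IncidenceAlgebra.mu ℤ (⊥ : P) (⊤ : P)

/-- The exponential generating function `∑ₙ (-1)^(n+1) μ(L_{n+1}) xⁿ / n!`. -/
noncomputable def mobiusEGF (k : ℕ) : PowerSeries ℚ :=
  PowerSeries.mk fun n =>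
    (-1) ^ (n + 1) * (mobiusNumber (BoundedWeightedPartition (n + 1) k) : ℚ) / (n.factorial : ℚ)

/-- The formal power series `(1 + c x) ^ a = ∑ₙ (a choose n) cⁿ xⁿ`. -/
noncomputable def onePlusMulXPow (c a : ℚ) : PowerSeries ℚ :=
  PowerSeries.rescale c (PowerSeries.binomialSeries ℚ a)

/-!
The Möbius function `μ(⊥, p)` of the poset of weighted partitions has a combinatorial formula: it is
the number, with sign `-1` to the number of edges, of forests on `{0, …, n - 1}` whose edges go from
a child to a smaller parent and carry a label in `Fin k`, such that the components of the edges with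
label at least `m` are the classes of layer `m` of `p`, for every `m` (`LabelledForest.components`).

To prove this, one has to sum the signs of all forests whose components lie below a given `p`, and to
get `0` unless `p = ⊥`.  The order of the poset turns into a condition on single edges: the
components of a forest lie below `p` if and only if every edge, from `b` to `a` with label `l`, is
admissible (`WeightedPartition.Admits`): `a` and `b` are equivalent in layer `l` of `p`, and `b` is
the least element of its class in all deeper layers (`LabelledForest.components_le_iff`).  In one
direction, edges of a forest are admissible for its components, and admissibility passes to larger
weighted partitions.  In the other direction, adding edges to a forest one at a time gives a chain
of coverings, and a forest with as many admissible edges as possible has `p` itself as its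
components.

Consequently the points choose their parents and labels independently, and the signed sum is the
product over `b` of `1 - #(admissible edges at b)`.  If `p ≠ ⊥`, then some point has exactly one
admissible edge (`WeightedPartition.exists_unique_admits`) and the product vanishes.

Summing over all `p` gives the signed number of all increasing forests, `∏ b < n, (1 - k b)`, and the
Möbius number of the bounded poset is its negative.  The power series identity is the comparison of
this product with the falling factorials in the binomial coefficients.
-/

/-! ### Admissible edges of a weighted partition -/

namespace WeightedPartition

variable {n k : ℕ}

/-- `p.Admits b a l`: the edge from the child `b` to the parent `a < b` with label `l` is admissible
for `p`, meaning that `a` and `b` are equivalent in layer `l` while `b` is the least element of its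
class in every deeper layer.  The label is determined by `b` alone: it is the deepest layer in which
`b` is not the least element of its class. -/
structure Admits (p : WeightedPartition n k) (b a : Fin n) (l : Fin k) : Prop where
  lt : a < b
  rel : p.layer l b a
  least : ∀ m, l < m → ∀ c, p.layer m b c → b ≤ c

theorem Admits.le_label {p : WeightedPartition n k} {a b c : Fin n} {l m : Fin k}
    (h : p.Admits b a l) (hbc : p.layer m b c) (hcb : c < b) : m ≤ l := by
  by_contra hlm
  exact absurd (h.least m (not_le.1 hlm) c hbc) (not_le.2 hcb)

theorem exists_admits (p : WeightedPartition n k) {b c : Fin n} {m : Fin k}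
    (hbc : p.layer m b c) (hcb : c < b) : ∃ a l, p.Admits b a l := by
  obtain ⟨l, ⟨a, hba, hab⟩, hmax⟩ :=
    Set.Finite.exists_maximal (s := {l : Fin k | ∃ a, p.layer l b a ∧ a < b})
      (Set.toFinite _) ⟨m, c, hbc, hcb⟩
  refine ⟨a, l, hab, hba, fun m' hm' c' hc' => ?_⟩
  by_contra hlt
  exact absurd (hmax ⟨c', hc', not_le.1 hlt⟩ hm'.le) (not_le.2 hm')

/-- Passing to a larger weighted partition keeps edges admissible.  In a covering with label
`(α, β)_m`, a point `b` that is the least element of its class before, but not after, the merging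
must be `β`; but `β` is the least element of its first-layer class, so it has no admissible edge. -/
theorem Admits.mono {p q : WeightedPartition n k} (hpq : p ≤ q) {a b : Fin n} {l : Fin k}
    (h : p.Admits b a l) : q.Admits b a l := by
  replace hpq : Relation.ReflTransGen Covers p q := hpq
  induction hpq with
  | refl => exact h
  | @tail q r _ hqr ih =>
    obtain ⟨α, β, m₀, hs⟩ := hqr
    have hfirst : ∀ m c, q.layer m β c → β ≤ c := fun m c hc =>
      hs.first_least c (q.antitone (Nat.zero_le _ : firstOf m₀ ≤ m) hc)
    refine ⟨ih.lt, (hs.merge _ _ _).2 (Or.inl ih.rel), fun m hm c hc => ?_⟩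
    rcases (hs.merge _ _ _).1 hc with hc | ⟨-, ⟨hbα, hcβ⟩ | ⟨hbβ, -⟩⟩
    · exact ih.least m hm c hc
    · exact (ih.least m hm α hbα).trans (hs.lt.le.trans (hfirst m c ((q.layer m).symm hcβ)))
    · have hb : b = β :=
        le_antisymm (ih.least m hm β hbβ) (hfirst m b ((q.layer m).symm hbβ))
      subst hb
      exact absurd (hfirst l a ih.rel) (not_le.2 ih.lt)

/-- A weighted partition other than `1/2/…/n` has a point with exactly one admissible edge: the
least point that is not the least element of its class in the deepest nontrivial layer. -/
theorem exists_unique_admits {p : WeightedPartition n k} (hp : p ≠ ⊥) :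
    ∃ b a l, p.Admits b a l ∧ ∀ a' l', p.Admits b a' l' → a' = a ∧ l' = l := by
  have hne : ∃ l : Fin k, ∃ b c, p.layer l b c ∧ c < b := by
    by_contra! hcon
    refine hp (WeightedPartition.ext <| funext fun m => Setoid.ext fun x y => ?_)
    refine ⟨fun h => le_antisymm (hcon m x y h) (hcon m y x ((p.layer m).symm h)), fun h => ?_⟩
    obtain rfl : x = y := h
    exact (p.layer m).refl x
  obtain ⟨L, hL, hmaxL⟩ :=
    Set.Finite.exists_maximal (s := {l : Fin k | ∃ b c, p.layer l b c ∧ c < b})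
      (Set.toFinite _) hne
  obtain ⟨b, ⟨c, hbc, hcb⟩, hminb⟩ :=
    Set.Finite.exists_minimal (s := {b : Fin n | ∃ c, p.layer L b c ∧ c < b})
      (Set.toFinite _) hL
  have hlabel : ∀ a l, p.Admits b a l → l = L := fun a l h => by
    have hLl : L ≤ l := h.le_label hbc hcb
    exact le_antisymm (hmaxL ⟨b, a, h.rel, h.lt⟩ hLl) hLl
  have hleast : ∀ a, p.layer L b a → a < b → ∀ c, p.layer L b c → a ≤ c := fun a hba hab c hc => by
    by_contra hca
    have := hminb ⟨c, (p.layer L).trans ((p.layer L).symm hba) hc, not_le.1 hca⟩ hab.le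
    exact absurd this (not_le.2 hab)
  obtain ⟨a, l, h⟩ := p.exists_admits hbc hcb
  obtain rfl := hlabel a l h
  refine ⟨b, a, l, h, fun a' l' h' => ?_⟩
  obtain rfl := hlabel a' l' h'
  exact ⟨le_antisymm (hleast a' h'.rel h'.lt a h.rel) (hleast a h.rel h.lt a' h'.rel), rfl⟩

theorem not_admits_bot (b a : Fin n) (l : Fin k) :
    ¬ (⊥ : WeightedPartition n k).Admits b a l := fun h => by
  have hba : b = a := h.rel
  exact absurd hba h.lt.ne'

end WeightedPartition

/-! ### Increasing labelled forests and their components -/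

/-- A labelled forest on `Fin n`: each point is either a root (`none`) or has a parent and a label in
`Fin k` on the edge to it.  Only forests in which parents are smaller than their children, see
`LabelledForest.Increasing`, are meaningful. -/
abbrev LabelledForest (n k : ℕ) : Type := Fin n → Option (Fin n × Fin k)

namespace LabelledForest

variable {n k : ℕ}

/-- Every parent is smaller than its child. -/
def Increasing (F : LabelledForest n k) : Prop := ∀ b a l, F b = some (a, l) → a < b

/-- The point reached from `b` by following edges with label at least `m` towards the root.  Edges
that are not increasing stop the walk, which makes the definition terminate. -/
def root (F : LabelledForest n k) (m : Fin k) (b : Fin n) : Fin n :=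
  match F b with
  | none => b
  | some (a, l) => if _h : a < b ∧ m ≤ l then root F m a else b
termination_by b
decreasing_by exact _h.1

theorem root_eq_self_of_none {F : LabelledForest n k} {b : Fin n} (h : F b = none) (m : Fin k) :
    F.root m b = b := by
  rw [root, h]

theorem root_eq_self_of_lt {F : LabelledForest n k} {a b : Fin n} {l m : Fin k}
    (h : F b = some (a, l)) (hlm : l < m) : F.root m b = b := by
  rw [root, h]
  simp [not_le.2 hlm]

theorem root_eq_root_of_le {F : LabelledForest n k} {a b : Fin n} {l m : Fin k}
    (h : F b = some (a, l)) (hab : a < b) (hml : m ≤ l) : F.root m b = F.root m a := by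
  rw [root, h]
  simp [hab, hml]

/-- Induction along the edges with label at least `m` of an increasing forest. -/
theorem Increasing.root_induction {F : LabelledForest n k} (hF : F.Increasing) (m : Fin k)
    {C : Fin n → Prop} (base : ∀ b, (∀ a l, F b = some (a, l) → l < m) → F.root m b = b → C b)
    (step : ∀ b a l, F b = some (a, l) → m ≤ l → F.root m b = F.root m a → C a → C b)
    (b : Fin n) : C b := by
  induction b using WellFoundedLT.induction with
  | _ b ih =>
    rcases hFb : F b with _ | ⟨a, l⟩
    · exact base b (by simp [hFb]) (root_eq_self_of_none hFb m)
    · have hab := hF b a l hFb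
      rcases le_or_gt m l with hml | hlm
      · exact step b a l hFb hml (root_eq_root_of_le hFb hab hml) (ih a hab)
      · refine base b (fun a' l' h => ?_) (root_eq_self_of_lt hFb hlm)
        obtain ⟨rfl, rfl⟩ : a = a' ∧ l = l' := by simpa [hFb] using h
        exact hlm

theorem Increasing.root_le {F : LabelledForest n k} (hF : F.Increasing) (m : Fin k) (b : Fin n) :
    F.root m b ≤ b := by
  induction b using hF.root_induction m with
  | base b _ h => exact h.le
  | step b a l hFb _ h ih => exact h.le.trans (ih.trans (hF b a l hFb).le)

theorem Increasing.root_root {F : LabelledForest n k} (hF : F.Increasing) {m m' : Fin k}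
    (hm : m ≤ m') (b : Fin n) : F.root m (F.root m' b) = F.root m b := by
  induction b using hF.root_induction m' with
  | base b _ h => rw [h]
  | step b a l hFb hml h ih =>
    rw [h, ih, root_eq_root_of_le hFb (hF b a l hFb) (hm.trans hml)]

/-- The weighted partition of an increasing forest: the classes of layer `m` are the components of
the forest formed by the edges with label at least `m`. -/
def components (F : LabelledForest n k) (hF : F.Increasing) : WeightedPartition n k where
  layer m := Setoid.ker (F.root m)
  antitone m m' hm x y h := by
    rw [Setoid.ker_def] at h ⊢
    rw [← hF.root_root hm x, h, hF.root_root hm y]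

theorem components_layer {F : LabelledForest n k} {hF : F.Increasing} {m : Fin k} {x y : Fin n} :
    (F.components hF).layer m x y ↔ F.root m x = F.root m y := Iff.rfl

theorem components_admits {F : LabelledForest n k} (hF : F.Increasing) {a b : Fin n} {l : Fin k}
    (h : F b = some (a, l)) : (F.components hF).Admits b a l where
  lt := hF b a l h
  rel := root_eq_root_of_le h (hF b a l h) le_rfl
  least m hm c hc := by
    rw [components_layer, root_eq_self_of_lt h hm] at hc
    exact hc.le.trans (hF.root_le m c)

theorem increasing_update {F : LabelledForest n k} (hF : F.Increasing) {a b : Fin n} (l : Fin k)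
    (hab : a < b) : Increasing (Function.update F b (some (a, l))) := by
  intro b' a' l' h
  rw [Function.update_apply] at h
  split_ifs at h with hb
  · simp only [Option.some.injEq, Prod.mk.injEq] at h
    rw [hb, ← h.1]
    exact hab
  · exact hF b' a' l' h

theorem root_update {F : LabelledForest n k} (hF : F.Increasing) {a b : Fin n} {l : Fin k}
    (hab : a < b) (hFb : F b = none) (m : Fin k) (x : Fin n) :
    root (Function.update F b (some (a, l))) m x =
      if m ≤ l ∧ F.root m x = b then F.root m a else F.root m x := by
  have hF' := increasing_update hF l hab
  induction x using hF'.root_induction m with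
  | base x hx h =>
    rw [h]
    rcases eq_or_ne x b with rfl | hxb
    · have := hx a l (by simp)
      rw [if_neg fun h => absurd h.1 (not_le.2 this), root_eq_self_of_none hFb]
    · have hr : F.root m x = x := by
        rcases hFx : F x with _ | ⟨c, l'⟩
        · exact root_eq_self_of_none hFx m
        · exact root_eq_self_of_lt hFx (hx c l' (by simp [hxb, hFx]))
      rw [hr, if_neg fun h => hxb h.2]
  | step x c l' hx hml h ih =>
    rw [h, ih]
    rcases eq_or_ne x b with rfl | hxb
    · simp only [Function.update_self, Option.some.injEq, Prod.mk.injEq] at hx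
      obtain ⟨rfl, rfl⟩ := hx
      have hne : F.root m a ≠ x := ((hF.root_le m a).trans_lt hab).ne
      rw [if_neg fun h => hne h.2, if_pos ⟨hml, root_eq_self_of_none hFb m⟩]
    · have hFx : F x = some (c, l') := by simpa [hxb] using hx
      rw [root_eq_root_of_le hFx (hF x c l' hFx) hml]

/-- Adding an edge to an increasing forest gives a covering.  The parent `a` may be replaced by the
least element of its class in layer `l`, which changes none of the components. -/
theorem components_covers_update {F : LabelledForest n k} (hF : F.Increasing) {a b : Fin n}
    {l : Fin k} (hab : a < b) (hFb : F b = none) :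
    (F.components hF).Covers (components _ (increasing_update hF l hab)) := by
  have hb : ∀ m, F.root m b = b := root_eq_self_of_none hFb
  have hne : ∀ m, F.root m (F.root l a) ≠ b := fun m =>
    ((hF.root_le m _).trans_lt ((hF.root_le l a).trans_lt hab)).ne
  have hleast : ∀ m c, (F.components hF).layer m b c → b ≤ c := fun m c h => by
    rw [components_layer, hb] at h
    exact h.le.trans (hF.root_le m c)
  refine ⟨F.root l a, b, l, (hF.root_le l a).trans_lt hab, ?_, hleast _, ?_, ?_, hleast _, ?_⟩
  · rw [components_layer, hb]
    exact hne _
  · rw [components_layer, hb]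
    exact hne _
  · intro c h
    rw [components_layer, hF.root_root le_rfl] at h
    exact h.le.trans (hF.root_le l c)
  · intro m x y
    simp only [components_layer, root_update hF hab hFb, hb]
    by_cases hml : m ≤ l
    · have hne' := hne m
      rw [hF.root_root hml] at hne' ⊢
      grind
    · simp [hml]

/-- The components of a forest lie below `p` exactly if all edges of the forest are admissible
for `p`.  For the converse direction, add admissible edges, each giving a covering, until every
point with an admissible edge has a parent; the components then are `p` itself. -/
theorem components_le_iff {F : LabelledForest n k} (hF : F.Increasing)
    (p : WeightedPartition n k) :
    F.components hF ≤ p ↔ ∀ b a l, F b = some (a, l) → p.Admits b a l := by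
  refine ⟨fun h b a l hb => (components_admits hF hb).mono h, fun h => ?_⟩
  generalize hN : {b | F b = none ∧ ∃ a l, p.Admits b a l}.ncard = N
  induction N using Nat.strong_induction_on generalizing F with
  | _ N ih =>
    by_cases hcomplete : ∃ b, F b = none ∧ ∃ a l, p.Admits b a l
    · obtain ⟨b, hFb, a, l, hbal⟩ := hcomplete
      refine le_trans (Relation.ReflTransGen.single
        (components_covers_update hF (l := l) hbal.lt hFb)) (ih _ ?_ _ ?_ rfl)
      · rw [← hN]
        refine Set.ncard_lt_ncard ⟨?_, fun hss => ?_⟩ (Set.toFinite _)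
        · rintro c ⟨hc, hadm⟩
          rw [Function.update_apply] at hc
          split_ifs at hc
          exact ⟨hc, hadm⟩
        · simpa using (hss ⟨hFb, a, l, hbal⟩).1
      · intro b' a' l' h'
        rw [Function.update_apply] at h'
        split_ifs at h' with hb
        · simp only [Option.some.injEq, Prod.mk.injEq] at h'
          obtain ⟨rfl, rfl⟩ := h'
          exact hb ▸ hbal
        · exact h b' a' l' h'
    · push Not at hcomplete
      refine le_of_eq (WeightedPartition.ext <| funext fun m => Setoid.ext fun x y => ?_)
      have hrel : ∀ x, p.layer m x (F.root m x) := fun x => by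
        induction x using hF.root_induction m with
        | base x _ h' => rw [h']
        | step x c l hx hml h' ihx =>
          rw [h']
          exact (p.layer m).trans (p.antitone hml (h x c l hx).rel) ihx
      have hleast : ∀ x c, p.layer m (F.root m x) c → F.root m x ≤ c := fun x => by
        induction x using hF.root_induction m with
        | base x hx h' =>
          rw [h']
          intro c hc
          by_contra hcx
          rcases hFx : F x with _ | ⟨a, l⟩
          · obtain ⟨a, l, hadm⟩ := p.exists_admits hc (not_le.1 hcx)
            exact hcomplete x hFx a l hadm
          · exact absurd ((h x a l hFx).le_label hc (not_le.1 hcx)) (not_le.2 (hx a l hFx))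
        | step x c l hx hml h' ihx => rwa [h']
      rw [components_layer]
      constructor
      · intro hxy
        exact (p.layer m).trans (hrel x) (hxy ▸ (p.layer m).symm (hrel y))
      · intro hxy
        have hroots : p.layer m (F.root m x) (F.root m y) :=
          (p.layer m).trans ((p.layer m).symm (hrel x)) ((p.layer m).trans hxy (hrel y))
        exact le_antisymm (hleast x _ hroots) (hleast y _ ((p.layer m).symm hroots))

end LabelledForest

/-! ### Möbius numbers after adding a greatest element -/

theorem sum_withTop {P : Type*} [Fintype P] [Fintype (WithTop P)] (f : WithTop P → ℤ) :
    ∑ x, f x = f ⊤ + ∑ y : P, f y := by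
  exact (Fintype.sum_equiv (Equiv.refl (Option P)) (ι := WithTop P) f f fun _ => rfl).trans
    (Fintype.sum_option f)

open scoped Classical in
/-- Let `f` be a function on a finite poset `P` with least element whose sums over lower intervals
vanish except at `⊥`, where the sum is `1`.  Then `f` is the Möbius function `μ(⊥, ·)`, and
the Möbius number of `P` with a new greatest element is minus the total sum of `f`. -/
theorem mobiusNumber_withTop {P : Type*} [PartialOrder P] [OrderBot P] [Finite P] [Fintype P]
    (f : P → ℤ) (hf : ∀ x, ∑ y with y ≤ x, f y = if x = ⊥ then 1 else 0) :
    mobiusNumber (WithTop P) = -∑ y, f y := by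
  unfold mobiusNumber
  let : Fintype (WithTop P) := Fintype.ofFinite _
  let : LocallyFiniteOrder (WithTop P) := Fintype.toLocallyFiniteOrder
  -- The value at `⊤` makes the sum over all of `WithTop P` vanish.
  let g : WithTop P → ℤ := WithTop.recTopCoe (-∑ y, f y) f
  have hg : ∀ x : WithTop P, (if x = ⊥ then 1 else 0) = ∑ y ∈ Finset.Iic x, g y := by
    intro x
    have hIic : Finset.Iic x = Finset.univ.filter (· ≤ x) := by ext; simp
    rw [hIic, Finset.sum_filter, sum_withTop]
    induction x using WithTop.recTopCoe with
    | top => simp [g]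
    | coe a =>
      rw [if_neg (WithTop.not_top_le_coe a), zero_add]
      simp only [WithTop.coe_le_coe, WithTop.coe_eq_bot, ← hf a, Finset.sum_filter]
      rfl
  have h := IncidenceAlgebra.moebius_inversion_bot g _ hg ⊤
  simp only [mul_ite, mul_one, mul_zero, Finset.sum_ite_eq', Finset.mem_Iic, bot_le, if_true] at h
  -- Only the instances on `ℤ` and on `WithTop P` are presented differently.
  convert h.symm <;> rfl

/-! ### Signed counting of increasing forests -/

namespace LabelledForest

variable {n k : ℕ}

/-- The contribution `1` or `-1` of a point to the sign of a forest, according to whether it is a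
root or carries an edge to a parent. -/
def edgeSign {ι : Type*} (o : Option ι) : ℤ := if o.isSome then -1 else 1

open scoped Classical in
/-- The choices of `none` or an edge from `E`. -/
noncomputable def choices {ι : Type*} [Fintype ι] (E : ι → Prop) : Finset (Option ι) :=
  Finset.univ.filter fun o => ∀ e, o = some e → E e

theorem mem_choices {ι : Type*} [Fintype ι] {E : ι → Prop} {o : Option ι} :
    o ∈ choices E ↔ ∀ e, o = some e → E e := by
  simp [choices]

theorem sum_choices {ι : Type*} [Fintype ι] (E : ι → Prop) [DecidablePred E] :
    ∑ o ∈ choices E, edgeSign o = 1 - (Finset.univ.filter E).card := by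
  rw [choices, Finset.sum_filter, Fintype.sum_option]
  simp [edgeSign, Finset.sum_ite, sub_eq_add_neg]

/-- The finite set of increasing forests. -/
noncomputable def increasingForests (n k : ℕ) : Finset (LabelledForest n k) :=
  Fintype.piFinset fun b => choices fun e : Fin n × Fin k => e.1 < b

theorem mem_increasingForests {F : LabelledForest n k} :
    F ∈ increasingForests n k ↔ F.Increasing := by
  simp [increasingForests, mem_choices, Increasing]

/-- The sign of a forest: `-1` to the number of its edges. -/
def sign (F : LabelledForest n k) : ℤ := ∏ b, edgeSign (F b)

/-- The point `b` has `k * b` possible edges, given by a parent among `0, …, b - 1` and a label. -/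
theorem sum_sign_increasingForests :
    ∑ F ∈ increasingForests n k, F.sign = ∏ b : Fin n, (1 - (k : ℤ) * (b : ℕ)) := by
  simp only [increasingForests, sign]
  rw [← Finset.prod_univ_sum]
  refine Finset.prod_congr rfl fun b _ => ?_
  rw [sum_choices]
  have : (Finset.univ.filter fun e : Fin n × Fin k => e.1 < b) = Finset.Iio b ×ˢ Finset.univ := by
    ext; simp
  rw [this, Finset.card_product, Fin.card_Iio, Finset.card_univ, Fintype.card_fin]
  push_cast
  ring

open scoped Classical in
/-- The signed number of increasing forests with components below `p` is a product over the
points, and one of its factors vanishes unless `p = ⊥`. -/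
theorem sum_sign_components_le (p : WeightedPartition n k) :
    ∑ F ∈ (increasingForests n k).attach with
      F.1.components (mem_increasingForests.1 F.2) ≤ p, F.1.sign = if p = ⊥ then 1 else 0 := by
  have hset : ∑ F ∈ (increasingForests n k).attach with
      F.1.components (mem_increasingForests.1 F.2) ≤ p, F.1.sign =
      ∑ F ∈ Fintype.piFinset fun b => choices fun e : Fin n × Fin k => p.Admits b e.1 e.2,
        sign F := by
    have hmem : ∀ F : LabelledForest n k,
        (F ∈ Fintype.piFinset fun b => choices fun e : Fin n × Fin k => p.Admits b e.1 e.2) ↔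
          ∀ b a l, F b = some (a, l) → p.Admits b a l := by
      simp [mem_choices]
    refine Finset.sum_bij (fun F _ => F.1) ?_ ?_ ?_ ?_
    · intro F hF
      rw [hmem, ← components_le_iff (mem_increasingForests.1 F.2)]
      exact (Finset.mem_filter.1 hF).2
    · intro F _ F' _ h
      exact Subtype.ext h
    · intro F hF
      rw [hmem] at hF
      have hinc : Increasing F := fun b a l h => (hF b a l h).lt
      exact ⟨⟨F, mem_increasingForests.2 hinc⟩, Finset.mem_filter.2
        ⟨Finset.mem_attach _ _, (components_le_iff hinc p).2 hF⟩, rfl⟩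
    · intro F _
      rfl
  rw [hset]
  simp only [sign]
  rw [← Finset.prod_univ_sum]
  simp only [sum_choices]
  split_ifs with hp
  · subst hp
    simp [WeightedPartition.not_admits_bot]
  · obtain ⟨b, a, l, h, huniq⟩ := WeightedPartition.exists_unique_admits hp
    refine Finset.prod_eq_zero (Finset.mem_univ b) ?_
    have : (Finset.univ.filter fun e : Fin n × Fin k => p.Admits b e.1 e.2) = {(a, l)} := by
      ext ⟨a', l'⟩
      simp only [Finset.mem_filter, Finset.mem_univ, true_and, Finset.mem_singleton, Prod.mk.injEq]
      refine ⟨huniq a' l', ?_⟩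
      rintro ⟨rfl, rfl⟩
      exact h
    rw [this]
    simp

end LabelledForest

/-! ### Möbius numbers and their generating function -/

open scoped Classical in
theorem mobiusNumber_eq_neg_prod (n k : ℕ) :
    mobiusNumber (BoundedWeightedPartition n k) = -∏ b : Fin n, (1 - (k : ℤ) * (b : ℕ)) := by
  let : Fintype (WeightedPartition n k) := Fintype.ofFinite _
  let φ : LabelledForest.increasingForests n k → WeightedPartition n k := fun F =>
    F.1.components (LabelledForest.mem_increasingForests.1 F.2)
  rw [mobiusNumber_withTop
    (fun p => ∑ F ∈ (LabelledForest.increasingForests n k).attach with φ F = p, F.1.sign)]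
  · rw [Finset.sum_fiberwise _ φ, Finset.sum_attach _ fun F => LabelledForest.sign F,
      LabelledForest.sum_sign_increasingForests]
  · intro p
    rw [← LabelledForest.sum_sign_components_le p,
      ← Finset.sum_fiberwise_of_maps_to (g := φ) (t := Finset.univ.filter (· ≤ p))
        (by simp [φ])]
    refine Finset.sum_congr rfl fun q hq => ?_
    rw [Finset.filter_filter]
    refine Finset.sum_congr (Finset.filter_congr fun F _ => ?_) fun _ _ => rfl
    have hqp : q ≤ p := (Finset.mem_filter.1 hq).2
    exact ⟨fun h => ⟨h.le.trans hqp, h⟩, fun h => h.2⟩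

/-- The factor of the point `0`, which has no possible parent, is `1` and drops out. -/
theorem mobiusNumber_succ (n k : ℕ) :
    mobiusNumber (BoundedWeightedPartition (n + 1) k) =
      (-1) ^ (n + 1) * ∏ j ∈ Finset.range n, ((k : ℤ) * ((j : ℤ) + 1) - 1) := by
  rw [mobiusNumber_eq_neg_prod, Fin.prod_univ_succ, pow_succ, ← Finset.card_range n,
    ← Finset.prod_const, Finset.card_range, Finset.prod_range, Finset.prod_range, mul_right_comm,
    ← Finset.prod_mul_distrib]
  simp

theorem factorial_mul_choose (a : ℚ) (n : ℕ) :
    (n.factorial : ℚ) * Ring.choose a n = ∏ j ∈ Finset.range n, (a - j) := by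
  rw [← nsmul_eq_mul, ← Ring.descPochhammer_eq_factorial_smul_choose,
    ← descPochhammer_eval_eq_prod_range, ← Polynomial.eval₂_smulOneHom_eq_smeval,
    ← descPochhammer_map (Int.castRingHom ℚ), Polynomial.eval_map]
  congr 1
  exact Subsingleton.elim _ _

theorem mainTheorem2 (k : ℕ) (hk : 1 ≤ k) :
    mobiusEGF k = onePlusMulXPow (-(k : ℚ)) (-(((k : ℚ) - 1) / (k : ℚ))) ∧
    ∀ n : ℕ, 1 ≤ n →
      mobiusNumber (BoundedWeightedPartition n k) =
        (-1) ^ n * ∏ j ∈ Finset.range (n - 1), ((k : ℤ) * ((j : ℤ) + 1) - 1) := by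
  refine ⟨?_, fun n hn => ?_⟩
  · ext n
    have hk0 : (k : ℚ) ≠ 0 := by positivity
    have hfact : (n.factorial : ℚ) ≠ 0 := by positivity
    rw [mobiusEGF, onePlusMulXPow, PowerSeries.coeff_mk, PowerSeries.coeff_rescale,
      PowerSeries.binomialSeries_coeff, mobiusNumber_succ, smul_eq_mul, mul_one,
      div_eq_iff hfact, mul_assoc, mul_comm (Ring.choose _ _), factorial_mul_choose]
    push_cast
    rw [← mul_assoc, ← mul_pow, ← Finset.card_range n, ← Finset.prod_const, Finset.card_range,
      ← Finset.prod_mul_distrib]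
    norm_num
    refine Finset.prod_congr rfl fun j _ => ?_
    field_simp
    ring
  · obtain ⟨n, rfl⟩ := Nat.exists_eq_add_of_le' hn
    exact mobiusNumber_succ n k
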